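/- Let $\mathbb F$ be an infinite field of characteristic not $2$, let $G$ be a finite simple graph without isolated vertices (for example, any connected graph with at least two vertices), and let $v$ be a cut vertex of $G$, i.e. a vertex whose deletion increases the number of connected components. For a finite simple graph $H$ on $n$ vertices let $mr^-(\mathbb F,H)$ denote the minimum rank of an $n\times n$ matrix $A=(a_{ij})$ over $\mathbb F$, with rows and columns indexed by the vertices of $H$, such that $A^T=-A$ and, for all $i\neq j$, $a_{ij}\neq 0$ if and only if $i$ and $j$ are adjacent in $H$. A complete multipartite graph means $K_{n_1,\dots,n_t}$ with $t\ge 2$ and all $n_i\ge 1$, and a graph is called nonempty if it has at least one edge. Then $mr^-(\mathbb F,G)=4$ if and only if at least one of the following two conditions holds: (i) $G=G_1\cup G_2$ for subgraphs $G_1,G_2$ of $G$ (that is, $V_G=V_{G_1}\cup V_{G_2}$ and $E_G=E_{G_1}\cup E_{G_2}$) such that $V_{G_1}\cap V_{G_2}=\{v\}$, both $G_1$ and $G_2$ are complete multipartite graphs, and both $G_1-v$ and $G_2-v$ are nonempty; (ii) one connected component of $G-v$ is a complete multipartite graph, and all other vertices of $G-v$ are isolated in $G-v$. -/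

import Mathlib

namespace MinSkewRank

/-- The graph `G(A)` of a square matrix `A`: distinct indices `i`, `j` are adjacent when the
`(i, j)` or the `(j, i)` entry is nonzero (for a skew-symmetric `A` these are equivalent). -/
def matrixGraph {F V : Type*} [Field F] (A : Matrix V V F) : SimpleGraph V :=
  SimpleGraph.fromRel fun i j => A i j ≠ 0

/-- `S⁻(F, G)`: the skew-symmetric matrices over `F` whose graph is `G`. -/
def skewMatrices (F : Type*) [Field F] {V : Type*} (G : SimpleGraph V) : Set (Matrix V V F) :=
  {A | A.transpose = -A ∧ matrixGraph A = G}

/-- The minimum skew rank `mr⁻(F, G)`. -/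
noncomputable def minSkewRank (F : Type*) [Field F] {V : Type*} [Fintype V]
    (G : SimpleGraph V) : ℕ :=
  sInf (Matrix.rank '' skewMatrices F G)

/-- The set of matrices over which the minimum skew rank is taken is never empty, so that
`minSkewRank` is an attained minimum. -/
theorem skewMatrices_nonempty (F : Type*) [Field F] {V : Type*} (G : SimpleGraph V) :
    (skewMatrices F G).Nonempty := by
  classical
  let _ : LinearOrder V := linearOrderOfSTO (WellOrderingRel (α := V))
  refine ⟨Matrix.of fun i j => if G.Adj i j then (if i < j then 1 else -1) else 0, ?_, ?_⟩
  · ext i j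
    by_cases h : G.Adj i j
    · rcases lt_or_gt_of_ne h.ne with h' | h'
      · simp [Matrix.transpose_apply, h, h.symm, h', h'.not_gt]
      · simp [Matrix.transpose_apply, h, h.symm, h', h'.not_gt]
    · simp [Matrix.transpose_apply, h, G.adj_comm j i]
  · ext i j
    by_cases h : G.Adj i j
    · by_cases h' : i < j <;> simp [matrixGraph, h, h', h.ne]
    · simp [matrixGraph, h, G.adj_comm j i]

/-- There is a matrix in `S⁻(F, G)` whose rank is the minimum skew rank. -/
theorem exists_rank_eq_minSkewRank (F : Type*) [Field F] {V : Type*} [Fintype V]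
    (G : SimpleGraph V) : ∃ A ∈ skewMatrices F G, A.rank = minSkewRank F G :=
  Nat.sInf_mem ((skewMatrices_nonempty F G).image _)

/-- The graph `G - v`. -/
abbrev deleteVertex {V : Type*} (G : SimpleGraph V) (v : V) : SimpleGraph {x : V // x ≠ v} :=
  G.comap Subtype.val

/-- `v` is a cut vertex of `G`: it separates two other vertices of one connected component
of `G` (equivalently, for a finite graph, deleting `v` increases the number of components). -/
def IsCutVertex {V : Type*} (G : SimpleGraph V) (v : V) : Prop :=
  ∃ x y : {x : V // x ≠ v}, G.Reachable x.1 y.1 ∧ ¬ (deleteVertex G v).Reachable x y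

/-- `G` is a complete multipartite graph `K_{n₁, …, n_t}` with `t ≥ 2` and all `nᵢ ≥ 1`: having
at least two (nonempty) parts is the same as having an edge. -/
def IsCompleteMultipartiteGraph {V : Type*} (G : SimpleGraph V) : Prop :=
  G.IsCompleteMultipartite ∧ G ≠ ⊥

/-- `G` is the union of two complete multipartite subgraphs `G₁`, `G₂` that have exactly the
vertex `v` in common, and both `G₁ - v` and `G₂ - v` have an edge. -/
def IsMultipartiteUnionAt {V : Type*} (G : SimpleGraph V) (v : V) : Prop :=
  ∃ G₁ G₂ : G.Subgraph,
    G₁ ⊔ G₂ = ⊤ ∧ G₁.verts ∩ G₂.verts = {v} ∧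
    IsCompleteMultipartiteGraph G₁.coe ∧ IsCompleteMultipartiteGraph G₂.coe ∧
    (G₁.deleteVerts {v}).edgeSet.Nonempty ∧ (G₂.deleteVerts {v}).edgeSet.Nonempty

/-- `H` consists of one complete multipartite component that has an edge, all the vertices outside
this component being isolated. -/
def IsMultipartitePlusIsolated {V : Type*} (H : SimpleGraph V) : Prop :=
  ∃ W : H.ConnectedComponent, IsCompleteMultipartiteGraph W.toSimpleGraph ∧
    ∀ x : V, x ∉ W → H.IsIsolated x

end MinSkewRank

/-! In characteristic not 2 a skew-symmetric matrix is alternating, and the Schur complement at a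
nonzero entry is again alternating, of rank at least two less (`rank_pivotComplement_add_two_le`).
Hence rank below 4 forces a zero Schur complement, and nonadjacency is then transitive through any
non-isolated vertex, as in a complete multipartite graph.

Sufficiency: over an infinite field a complete multipartite graph is realised by `x i * y j - y i *
x j`, and so is a star; two such forms give rank at most 4. Pivoting on one edge while another
survives gives rank at least 4.

Necessity: rank below 6 leaves rank below 4 after one pivot. The pivot is an edge whose Schur
complement leaves the relevant part unchanged: an edge of another component of `G - v`, or an edge
joining `v` to an isolated vertex of `G - v`. -/

namespace MinSkewRank

/-! ### Schur complements of alternating matrices -/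

section Pivot

variable {F V : Type*} [Field F]

/-- The matrix is alternating: skew-symmetric with zero diagonal. -/
def IsAlternating (A : Matrix V V F) : Prop :=
  (∀ i j, A i j = -A j i) ∧ ∀ i, A i i = 0

/-- The Schur complement of `A` with respect to the principal submatrix on `{c, d}`, as a matrix
on the full index type. -/
def pivotComplement (A : Matrix V V F) (c d : V) : Matrix V V F :=
  Matrix.of fun i j => A i j - (A i c * A d j - A i d * A c j) / A d c

theorem pivotComplement_apply (A : Matrix V V F) (c d i j : V) :
    pivotComplement A c d i j = A i j - (A i c * A d j - A i d * A c j) / A d c := rfl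

theorem isAlternating_pivotComplement {A : Matrix V V F} (hA : IsAlternating A) (c d : V) :
    IsAlternating (pivotComplement A c d) := by
  refine ⟨fun i j => ?_, fun i => ?_⟩
  · rw [pivotComplement_apply, pivotComplement_apply, hA.1 j i, hA.1 j c, hA.1 j d, hA.1 d i,
      hA.1 c i]
    ring
  · rw [pivotComplement_apply, hA.2 i, hA.1 d i, hA.1 c i]
    ring

variable [Fintype V]

/-- The kernel of the Schur complement contains both `ker A` and the span of the basis vectors at
`c` and `d`; these meet trivially because the block on `{c, d}` is invertible. -/
theorem rank_pivotComplement_add_two_le {A : Matrix V V F} (hA : IsAlternating A) {c d : V}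
    (h : A d c ≠ 0) : (pivotComplement A c d).rank + 2 ≤ A.rank := by
  classical
  set S := pivotComplement A c d with hS
  have hcd : A c d ≠ 0 := by rw [hA.1 c d]; simpa using h
  have hle : LinearMap.ker A.mulVecLin ≤ LinearMap.ker S.mulVecLin := by
    intro x hx
    rw [LinearMap.mem_ker, Matrix.mulVecLin_apply] at hx ⊢
    have hx' : ∀ i, ∑ j, A i j * x j = 0 := fun i => congrFun hx i
    funext i
    have : (S.mulVec x) i = ∑ j, A i j * x j -
        (A i c / A d c * ∑ j, A d j * x j - A i d / A d c * ∑ j, A c j * x j) := by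
      simp only [Matrix.mulVec, dotProduct, Finset.mul_sum, ← Finset.sum_sub_distrib, hS,
        pivotComplement_apply]
      refine Finset.sum_congr rfl fun j _ => ?_
      ring
    rw [this, hx', hx', hx']
    simp
  let g : (Fin 2 → F) →ₗ[F] (V → F) :=
    (LinearMap.single F (fun _ : V => F) c).comp (LinearMap.proj 0) +
      (LinearMap.single F (fun _ : V => F) d).comp (LinearMap.proj 1)
  have hg : ∀ (M : Matrix V V F) (t : Fin 2 → F) (i : V),
      M.mulVec (g t) i = M i c * t 0 + M i d * t 1 := by
    intro M t i
    simp [g, Matrix.mulVec_add, mul_comm]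
  have hinj : Function.Injective (A.mulVecLin.comp g) := by
    rw [← LinearMap.ker_eq_bot, LinearMap.ker_eq_bot']
    intro t ht
    have h1 : A c c * t 0 + A c d * t 1 = 0 := (hg A t c).symm.trans (congrFun ht c)
    have h2 : A d c * t 0 + A d d * t 1 = 0 := (hg A t d).symm.trans (congrFun ht d)
    rw [hA.2] at h1 h2
    simp only [zero_mul, zero_add, add_zero, mul_eq_zero, h, hcd, false_or] at h1 h2
    funext k
    fin_cases k
    · exact h2
    · exact h1
  have hgS : LinearMap.range g ≤ LinearMap.ker S.mulVecLin := by
    rintro _ ⟨t, rfl⟩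
    rw [LinearMap.mem_ker, Matrix.mulVecLin_apply]
    funext i
    rw [hg, hS, pivotComplement_apply, pivotComplement_apply, hA.2 c, hA.2 d, hA.1 c d]
    simp only [Pi.zero_apply]
    field_simp
    ring
  have hdisj : Disjoint (LinearMap.ker A.mulVecLin) (LinearMap.range g) := by
    rw [Submodule.disjoint_def]
    rintro _ hx ⟨t, rfl⟩
    have : (A.mulVecLin.comp g) t = (A.mulVecLin.comp g) 0 := by
      rw [map_zero]; exact hx
    rw [hinj this, map_zero]
  have hgr : Module.finrank F (LinearMap.range g) = 2 := by
    rw [LinearMap.finrank_range_of_inj (Function.Injective.of_comp (f := A.mulVecLin) hinj)]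
    simp
  have h1 := LinearMap.finrank_range_add_finrank_ker A.mulVecLin
  have h2 := LinearMap.finrank_range_add_finrank_ker S.mulVecLin
  have h3 := Submodule.finrank_mono (sup_le hle hgS)
  have h4 := Submodule.finrank_sup_add_finrank_inf_eq (LinearMap.ker A.mulVecLin)
    (LinearMap.range g)
  rw [hdisj.eq_bot, finrank_bot, hgr] at h4
  unfold Matrix.rank
  omega

theorem IsAlternating.two_le_rank {A : Matrix V V F} (hA : IsAlternating A) {c d : V}
    (h : A c d ≠ 0) : 2 ≤ A.rank := by
  have := rank_pivotComplement_add_two_le hA h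
  omega

/-- The `2 × 2` Plücker relations of an alternating matrix of rank two. -/
theorem IsAlternating.pivotComplement_eq_zero {A : Matrix V V F} (hA : IsAlternating A)
    (hr : A.rank < 4) {c d : V} (h : A d c ≠ 0) (i j : V) : pivotComplement A c d i j = 0 := by
  by_contra hij
  have h1 := rank_pivotComplement_add_two_le hA h
  have h2 := (isAlternating_pivotComplement hA c d).two_le_rank hij
  omega

theorem IsAlternating.apply_eq_zero_trans {A : Matrix V V F} (hA : IsAlternating A)
    (hr : A.rank < 4) {i j k l : V} (hjl : A j l ≠ 0) (hij : A i j = 0) (hjk : A j k = 0) :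
    A i k = 0 := by
  have hlj : A l j ≠ 0 := by rw [hA.1 l j]; simpa using hjl
  have := hA.pivotComplement_eq_zero hr hlj i k
  simpa [pivotComplement_apply, hij, hjk] using this

theorem IsAlternating.four_le_rank {A : Matrix V V F} (hA : IsAlternating A) {u v a b : V}
    (huv : A v u ≠ 0) (hab : A a b ≠ 0) (hua : A a u = 0) (hub : A u b = 0) : 4 ≤ A.rank := by
  by_contra hr
  have := hA.pivotComplement_eq_zero (by omega) huv a b
  simp [pivotComplement_apply, hua, hub, hab] at this

theorem rank_le_two_of_apply_eq {A : Matrix V V F} {x y : V → F}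
    (h : ∀ i j, A i j = x i * y j - y i * x j) : A.rank ≤ 2 := by
  have : A = Matrix.of (fun i => ![x i, y i]) * Matrix.of ![y, -x] := by
    ext i j
    simp [Matrix.mul_apply, Fin.sum_univ_two, h]
    ring
  rw [this]
  exact (Matrix.rank_mul_le_left _ _).trans ((Matrix.rank_le_card_width _).trans_eq (Fintype.card_fin _))

theorem rank_le_four_of_apply_eq {A : Matrix V V F} {x y z w : V → F}
    (h : ∀ i j, A i j = (x i * y j - y i * x j) + (z i * w j - w i * z j)) : A.rank ≤ 4 := by
  have : A = Matrix.of (fun i => ![x i, y i, z i, w i]) * Matrix.of ![y, -x, w, -z] := by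
    ext i j
    simp [Matrix.mul_apply, Fin.sum_univ_four, h]
    ring
  rw [this]
  exact (Matrix.rank_mul_le_left _ _).trans ((Matrix.rank_le_card_width _).trans_eq (Fintype.card_fin _))

end Pivot

/-! ### From matrices to graphs -/

section Graph

variable {F V : Type*} [Field F] {G : SimpleGraph V}

theorem isAlternating_of_mem_skewMatrices (hF : ringChar F ≠ 2) {A : Matrix V V F}
    (hA : A ∈ skewMatrices F G) : IsAlternating A := by
  have h : ∀ i j, A i j = -A j i := fun i j => congrFun (congrFun hA.1 j) i
  exact ⟨h, fun i => (Ring.eq_self_iff_eq_zero_of_char_ne_two hF).1 (h i i).symm⟩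

theorem IsAlternating.mem_skewMatrices_iff {A : Matrix V V F} (hA : IsAlternating A) :
    A ∈ skewMatrices F G ↔ ∀ i j, G.Adj i j ↔ A i j ≠ 0 := by
  have hadj : ∀ i j, (matrixGraph A).Adj i j ↔ A i j ≠ 0 := by
    intro i j
    have : i ≠ j ∧ A i j ≠ 0 ↔ A i j ≠ 0 :=
      and_iff_right_of_imp fun h => by rintro rfl; exact h (hA.2 i)
    simpa [matrixGraph, hA.1 j i] using this
  constructor
  · rintro ⟨-, rfl⟩
    exact hadj
  · intro h
    refine ⟨by ext i j; exact hA.1 j i, ?_⟩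
    ext i j
    rw [hadj, h]

variable [Fintype V]

theorem minSkewRank_le {A : Matrix V V F} (hA : IsAlternating A)
    (h : ∀ i j, G.Adj i j ↔ A i j ≠ 0) : minSkewRank F G ≤ A.rank :=
  Nat.sInf_le ⟨A, hA.mem_skewMatrices_iff.2 h, rfl⟩

theorem exists_isAlternating (hF : ringChar F ≠ 2) (G : SimpleGraph V) :
    ∃ A : Matrix V V F, IsAlternating A ∧ (∀ i j, G.Adj i j ↔ A i j ≠ 0) ∧
      A.rank = minSkewRank F G := by
  obtain ⟨A, hA, hr⟩ := exists_rank_eq_minSkewRank F G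
  have h := isAlternating_of_mem_skewMatrices hF hA
  exact ⟨A, h, h.mem_skewMatrices_iff.1 hA, hr⟩

theorem minSkewRank_le_two {x y : V → F} (h : ∀ i j, G.Adj i j ↔ x i * y j - y i * x j ≠ 0) :
    minSkewRank F G ≤ 2 :=
  (minSkewRank_le (A := Matrix.of fun i j => x i * y j - y i * x j)
    ⟨fun i j => by simp only [Matrix.of_apply]; ring,
      fun i => by simp only [Matrix.of_apply]; ring⟩ h).trans
    (rank_le_two_of_apply_eq fun _ _ => rfl)

theorem minSkewRank_le_four {x y z w : V → F}
    (h : ∀ i j, G.Adj i j ↔ (x i * y j - y i * x j) + (z i * w j - w i * z j) ≠ 0) :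
    minSkewRank F G ≤ 4 :=
  (minSkewRank_le (A := Matrix.of fun i j =>
      (x i * y j - y i * x j) + (z i * w j - w i * z j))
    ⟨fun i j => by simp only [Matrix.of_apply]; ring,
      fun i => by simp only [Matrix.of_apply]; ring⟩ h).trans
    (rank_le_four_of_apply_eq fun _ _ => rfl)

theorem four_le_minSkewRank (hF : ringChar F ≠ 2) {u v a b : V} (huv : G.Adj u v)
    (hab : G.Adj a b) (hua : ¬ G.Adj u a) (hub : ¬ G.Adj u b) : 4 ≤ minSkewRank F G := by
  obtain ⟨A, hA, h, hr⟩ := exists_isAlternating hF G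
  rw [← hr]
  refine hA.four_le_rank ((h _ _).1 huv.symm) ((h _ _).1 hab) ?_ ?_
  · simpa using (h _ _).not.1 fun h' => hua h'.symm
  · simpa using (h _ _).not.1 hub

/-- If the minimum skew rank is less than six and the edge `cd` is not joined to `R` in an
essential way, then nonadjacency is transitive on `R`. -/
theorem nonadj_trans_of_minSkewRank_lt_six (hF : ringChar F ≠ 2) (hr : minSkewRank F G < 6)
    {c d : V} (hcd : G.Adj c d) {R : Set V}
    (hR : ∀ i ∈ R, ∀ j ∈ R, i ≠ j →
      (¬ G.Adj i c ∨ ¬ G.Adj d j) ∧ (¬ G.Adj i d ∨ ¬ G.Adj c j))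
    {i j k l : V} (hi : i ∈ R) (hj : j ∈ R) (hk : k ∈ R) (hl : l ∈ R) (hjl : G.Adj j l)
    (hij : ¬ G.Adj i j) (hjk : ¬ G.Adj j k) : ¬ G.Adj i k := by
  obtain ⟨A, hA, h, hrA⟩ := exists_isAlternating hF G
  have hdc : A d c ≠ 0 := (h _ _).1 hcd.symm
  have hS := isAlternating_pivotComplement hA c d
  have hrS := rank_pivotComplement_add_two_le hA hdc
  -- Diagonal entries agree because both matrices are alternating, so `hR` is needed only for
  -- distinct indices.
  have key : ∀ i ∈ R, ∀ j ∈ R, pivotComplement A c d i j = A i j := by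
    intro i hi j hj
    rcases eq_or_ne i j with rfl | hne
    · rw [hS.2, hA.2]
    · obtain ⟨h1, h2⟩ := hR i hi j hj hne
      simp only [h, not_not] at h1 h2
      rw [pivotComplement_apply, mul_eq_zero.2 h1, mul_eq_zero.2 h2]
      simp
  rw [h, not_not] at hij hjk ⊢
  rw [h] at hjl
  rw [← key i hi k hk]
  refine hS.apply_eq_zero_trans (by omega) (l := l) (j := j) ?_ ?_ ?_
  · rwa [key j hj l hl]
  · rwa [key i hi j hj]
  · rwa [key j hj k hk]

end Graph

/-! ### Realising complete multipartite graphs -/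

section Multipartite

theorem exists_separating_of_isCompleteMultipartite (F : Type*) [Infinite F] {U : Type*} [Finite U]
    {K : SimpleGraph U} (hK : K.IsCompleteMultipartite) :
    ∃ f : U → F, ∀ i j, K.Adj i j ↔ f i ≠ f j := by
  obtain ⟨n, ⟨e⟩⟩ := Finite.exists_equiv_fin (Quotient hK.setoid)
  refine ⟨fun i => Infinite.natEmbedding F (e (Quotient.mk hK.setoid i)), fun i j => ?_⟩
  simp only [ne_eq, EmbeddingLike.apply_eq_iff_eq, Fin.val_inj]
  rw [Quotient.eq]
  exact not_not.symm

theorem exists_vectors_of_isCompleteMultipartite (F : Type*) [Field F] [Infinite F] {V : Type*}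
    [Finite V] {s : Set V} {K : SimpleGraph s} (hK : K.IsCompleteMultipartite) :
    ∃ x y : V → F, ∀ i j, x i * y j - y i * x j ≠ 0 ↔
      ∃ (hi : i ∈ s) (hj : j ∈ s), K.Adj ⟨i, hi⟩ ⟨j, hj⟩ := by
  classical
  obtain ⟨f, hf⟩ := exists_separating_of_isCompleteMultipartite F hK
  refine ⟨fun i => if i ∈ s then 1 else 0, fun i => if h : i ∈ s then f ⟨i, h⟩ else 0,
    fun i j => ?_⟩
  by_cases hi : i ∈ s <;> by_cases hj : j ∈ s <;> simp [hi, hj, hf, sub_eq_zero, eq_comm (a := f ⟨j, _⟩)]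

end Multipartite

/-! ### Sufficiency -/

section Sufficiency

variable {F V : Type*} [Field F] [Infinite F] [Fintype V] {G : SimpleGraph V} {v : V}

theorem IsMultipartiteUnionAt.minSkewRank_eq_four (hF : ringChar F ≠ 2)
    (h : IsMultipartiteUnionAt G v) : minSkewRank F G = 4 := by
  obtain ⟨G₁, G₂, hsup, hint, h₁, h₂, hE₁, hE₂⟩ := h
  have hadj : ∀ i j, G.Adj i j ↔ G₁.Adj i j ∨ G₂.Adj i j := fun i j => by
    rw [← SimpleGraph.Subgraph.sup_adj, hsup, SimpleGraph.Subgraph.top_adj]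
  have hv : ∀ i, i ∈ G₁.verts → i ∈ G₂.verts → i = v := fun i hi hi' => by
    have : i ∈ G₁.verts ∩ G₂.verts := ⟨hi, hi'⟩
    rwa [hint] at this
  apply le_antisymm
  · obtain ⟨x, y, hxy⟩ := exists_vectors_of_isCompleteMultipartite F h₁.1
    obtain ⟨z, w, hzw⟩ := exists_vectors_of_isCompleteMultipartite F h₂.1
    refine minSkewRank_le_four (x := x) (y := y) (z := z) (w := w) fun i j => ?_
    have e₁ : G₁.Adj i j ↔ x i * y j - y i * x j ≠ 0 := by
      rw [hxy]
      exact ⟨fun h => ⟨h.fst_mem, h.snd_mem, h⟩, fun ⟨_, _, h⟩ => h⟩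
    have e₂ : G₂.Adj i j ↔ z i * w j - w i * z j ≠ 0 := by
      rw [hzw]
      exact ⟨fun h => ⟨h.fst_mem, h.snd_mem, h⟩, fun ⟨_, _, h⟩ => h⟩
    rw [hadj]
    -- The two forms never overlap: an edge of both subgraphs would have both ends equal to `v`.
    by_cases a₁ : G₁.Adj i j
    · have a₂ : ¬ G₂.Adj i j := fun a₂ => a₁.ne
        ((hv i a₁.fst_mem a₂.fst_mem).trans (hv j a₁.snd_mem a₂.snd_mem).symm)
      rw [not_not.1 (e₂.not.1 a₂), add_zero, ← e₁]
      exact or_iff_left a₂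
    · rw [not_not.1 (e₁.not.1 a₁), zero_add, ← e₂]
      exact or_iff_right a₁
  · obtain ⟨e, he⟩ := hE₁
    obtain ⟨e', he'⟩ := hE₂
    induction e with | _ a b
    induction e' with | _ c d
    rw [SimpleGraph.Subgraph.mem_edgeSet, SimpleGraph.Subgraph.deleteVerts_adj] at he he'
    obtain ⟨ha, hav, hb, hbv, hab⟩ := he
    obtain ⟨hc, hcv, -, -, hcd⟩ := he'
    have hn : ∀ k, k ∈ G₁.verts → k ∉ ({v} : Set V) → ¬ G.Adj c k := by
      intro k hk hkv hck
      rcases (hadj _ _).1 hck with h | h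
      · exact hcv (hv c h.fst_mem hc)
      · exact hkv (hv k hk h.snd_mem)
    exact four_le_minSkewRank hF ((hadj c d).2 (Or.inr hcd)) ((hadj a b).2 (Or.inl hab))
      (hn a ha hav) (hn b hb hbv)

theorem IsMultipartitePlusIsolated.minSkewRank_eq_four (hF : ringChar F ≠ 2)
    (hG : ∀ u : V, ¬ G.IsIsolated u) (hv : IsCutVertex G v)
    (h : IsMultipartitePlusIsolated (deleteVertex G v)) : minSkewRank F G = 4 := by
  classical
  obtain ⟨W, ⟨hW, hne⟩, hiso⟩ := h
  have hWadj : ∀ i j : {x : V // x ≠ v}, (deleteVertex G v).Adj i j → i ∈ W := fun i j hij => by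
    by_contra hi
    exact hiso i hi j hij
  apply le_antisymm
  · obtain ⟨x, y, hxy⟩ := exists_vectors_of_isCompleteMultipartite F hW
    let ext (t : {x : V // x ≠ v} → F) (i : V) : F := if h : i ≠ v then t ⟨i, h⟩ else 0
    -- The second form realises the star of edges at `v`.
    refine minSkewRank_le_four (x := ext x) (y := ext y) (z := Pi.single v 1)
      (w := fun j => if G.Adj v j then 1 else 0) fun i j => ?_
    by_cases hi : i = v <;> by_cases hj : j = v
    · subst hi hj
      simp [ext]
    · subst hi
      simp [ext, hj]
    · subst hj
      simp [ext, hi, G.adj_comm]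
    · have := hxy ⟨i, hi⟩ ⟨j, hj⟩
      simp only [ext, ne_eq, hi, hj, not_false_eq_true, dite_true, Pi.single_eq_of_ne, zero_mul,
        mul_zero, sub_self, add_zero]
      refine Iff.trans ?_ this.symm
      exact ⟨fun h => ⟨hWadj ⟨i, hi⟩ ⟨j, hj⟩ h, hWadj ⟨j, hj⟩ ⟨i, hi⟩ h.symm, h⟩,
        fun ⟨_, _, h⟩ => h⟩
  · obtain ⟨a, b, hab⟩ := SimpleGraph.ne_bot_iff_exists_adj.1 hne
    obtain ⟨u, hu⟩ : ∃ u, u ∉ W := by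
      by_contra! hall
      obtain ⟨p, q, -, hpq⟩ := hv
      exact hpq (SimpleGraph.ConnectedComponent.exact
        ((hall p : _ = W).trans (hall q : _ = W).symm))
    have hu' : ∀ k : {x : V // x ≠ v}, ¬ G.Adj u k := fun k => hiso u hu k
    obtain ⟨k, hk⟩ : ∃ k, G.Adj u k := by
      have := hG u
      rw [SimpleGraph.IsIsolated] at this
      push Not at this
      exact this
    exact four_le_minSkewRank hF hk (show G.Adj a.1 b.1 from hab) (hu' _) (hu' _)

end Sufficiency

/-! ### Necessity -/

section Necessity

variable {F V : Type*} [Field F] {G : SimpleGraph V} {v : V}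

theorem exists_reachable_adj_of_not_reachable {x y : {x : V // x ≠ v}}
    (hxy : G.Reachable x.1 y.1) (hn : ¬ (deleteVertex G v).Reachable x y) :
    ∃ w, (deleteVertex G v).Reachable x w ∧ G.Adj w v := by
  by_contra! hall
  -- With no edge to `v`, the component of `x` in `G - v` is closed under adjacency in `G`.
  have key : ∀ z : V, G.Reachable x.1 z →
      ∃ hz : z ≠ v, (deleteVertex G v).Reachable x ⟨z, hz⟩ := by
    intro z hz
    rw [SimpleGraph.reachable_iff_reflTransGen] at hz
    induction hz with
    | refl => exact ⟨x.2, .rfl⟩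
    | @tail b c _ hbc ih =>
      obtain ⟨hb, hr⟩ := ih
      have hc : c ≠ v := by
        rintro rfl
        exact hall _ hr hbc
      refine ⟨hc, hr.trans (SimpleGraph.Adj.reachable ?_)⟩
      exact hbc
  exact hn (key y.1 hxy).2

variable [Fintype V]

theorem not_isIsolated_iff {U : Type*} {K : SimpleGraph U} {u : U} :
    ¬ K.IsIsolated u ↔ ∃ w, K.Adj u w := by
  simp [SimpleGraph.IsIsolated]

/-- The vertex `v` together with the vertices of `G - v` outside the component of `c`. -/
def outside (G : SimpleGraph V) (v : V) (c : {x : V // x ≠ v}) : Set V :=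
  {i | ∀ hi : i ≠ v, ¬ (deleteVertex G v).Reachable ⟨i, hi⟩ c}

/-- Only `v` can be adjacent to `c` or `d` from outside, and of two distinct vertices one is not
`v`, so pivoting on `cd` changes nothing there. -/
theorem outside_nonadj_trans (hF : ringChar F ≠ 2) (hr : minSkewRank F G < 6)
    {c d : {x : V // x ≠ v}} (hcd : (deleteVertex G v).Adj c d) {i j k l : V}
    (hi : i ∈ outside G v c) (hj : j ∈ outside G v c) (hk : k ∈ outside G v c)
    (hl : l ∈ outside G v c) (hjl : G.Adj j l) (hij : ¬ G.Adj i j) (hjk : ¬ G.Adj j k) :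
    ¬ G.Adj i k := by
  have hc : ∀ i ∈ outside G v c, i ≠ v → ¬ G.Adj i c := fun i hi hiv h =>
    hi hiv (SimpleGraph.Adj.reachable (G := deleteVertex G v) (u := ⟨i, hiv⟩) h)
  have hd : ∀ i ∈ outside G v c, i ≠ v → ¬ G.Adj i d := fun i hi hiv h =>
    hi hiv ((SimpleGraph.Adj.reachable (G := deleteVertex G v) (u := ⟨i, hiv⟩) h).trans
      hcd.symm.reachable)
  refine nonadj_trans_of_minSkewRank_lt_six hF hr (show G.Adj c.1 d.1 from hcd)
    (R := outside G v c) ?_ hi hj hk hl hjl hij hjk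
  intro p hp q hq hpq
  by_cases hpv : p = v
  · have hqv : q ≠ v := fun h => hpq (hpv.trans h.symm)
    exact ⟨.inr fun h => hd q hq hqv h.symm, .inr fun h => hc q hq hqv h.symm⟩
  · exact ⟨.inl (hc p hp hpv), .inl (hd p hp hpv)⟩

/-- If two edges of `G - v` lie in different components, then `G` is a multipartite union. -/
theorem isMultipartiteUnionAt_of_minSkewRank (hF : ringChar F ≠ 2)
    (hG : ∀ u : V, ¬ G.IsIsolated u) (hv : IsCutVertex G v) (hr : minSkewRank F G = 4)
    {a b c d : {x : V // x ≠ v}} (hab : (deleteVertex G v).Adj a b)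
    (hcd : (deleteVertex G v).Adj c d) (hac : ¬ (deleteVertex G v).Reachable a c) :
    IsMultipartiteUnionAt G v := by
  set H := deleteVertex G v
  have hHG : ∀ {p q : {x : V // x ≠ v}}, H.Adj p q ↔ G.Adj p q := Iff.rfl
  have hmem : ∀ {p e : {x : V // x ≠ v}}, ¬ H.Reachable p e → p.1 ∈ outside G v e :=
    fun h _ => h
  have hnbr : ∀ (e p : {x : V // x ≠ v}), ¬ H.Reachable p e →
      ∃ l ∈ outside G v e, G.Adj p l := by
    intro e p hp
    obtain ⟨l, hl⟩ := not_isIsolated_iff.1 (hG p)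
    refine ⟨l, fun hlv hle => hp ?_, hl⟩
    exact (SimpleGraph.Adj.reachable (hHG.2 hl : H.Adj p ⟨l, hlv⟩)).trans hle
  -- A vertex of a third component would be nonadjacent to both `a` and `b`, making `a` and `b`
  -- nonadjacent.
  have hcover : ∀ u, H.Reachable u a ∨ H.Reachable u c := by
    intro u
    by_contra! hu
    obtain ⟨l, hl, hul⟩ := hnbr c u hu.2
    have hau : ¬ G.Adj a u := fun h => hu.1 (hHG.2 h : H.Adj a u).symm.reachable
    have hub : ¬ G.Adj u b := fun h =>
      hu.1 ((hHG.2 h : H.Adj u b).reachable.trans hab.symm.reachable)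
    exact outside_nonadj_trans hF (by omega) hcd (hmem hac) (hmem hu.2)
      (hmem fun h => hac (hab.reachable.trans h)) hl hul hau hub hab
  -- This allows `v` itself to be the middle vertex in the transitivity argument.
  have hvn : ∀ e : {x : V // x ≠ v}, ∃ l ∈ outside G v e, G.Adj v l := by
    have hcut : ∀ e x y : {x : V // x ≠ v}, G.Reachable x.1 y.1 → ¬ H.Reachable x y → ¬ H.Reachable x e →
        ∃ l ∈ outside G v e, G.Adj v l := by
      intro e x y hxy hn hx
      obtain ⟨w, hxw, hw⟩ := exists_reachable_adj_of_not_reachable hxy hn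
      exact ⟨w, hmem fun h => hx (hxw.trans h), hw.symm⟩
    intro e
    obtain ⟨x, y, hxy, hn⟩ := hv
    by_cases hx : H.Reachable x e
    · exact hcut e y x hxy.symm (fun h => hn h.symm) fun h => hn (hx.trans h.symm)
    · exact hcut e x y hxy hn hx
  have hcm : ∀ {p q e : {x : V // x ≠ v}} (_ : H.Adj p q) (_ : ¬ H.Reachable p e)
      (_ : ∃ f, H.Adj e f) (_ : ∃ l ∈ outside G v e, G.Adj v l),
      IsCompleteMultipartiteGraph ((⊤ : G.Subgraph).induce (outside G v e)).coe ∧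
        (((⊤ : G.Subgraph).induce (outside G v e)).deleteVerts {v}).edgeSet.Nonempty := by
    intro p q e hpq hpe ⟨f, hef⟩ hvl
    have hqe : ¬ H.Reachable q e := fun h => hpe (hpq.reachable.trans h)
    refine ⟨⟨⟨?_⟩, ?_⟩, ⟨s(p.1, q.1), ?_⟩⟩
    · rintro ⟨i, hi⟩ ⟨j, hj⟩ ⟨k, hk⟩ hij hjk
      obtain ⟨l, hl, hjl⟩ : ∃ l ∈ outside G v e, G.Adj j l := by
        by_cases hjv : j = v
        · rwa [hjv]
        · exact hnbr e ⟨j, hjv⟩ (hj hjv)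
      have hi' : i ∈ outside G v e := hi
      have hj' : j ∈ outside G v e := hj
      have hk' : k ∈ outside G v e := hk
      simp only [SimpleGraph.Subgraph.coe_adj, SimpleGraph.Subgraph.induce_adj,
        SimpleGraph.Subgraph.top_adj, hi', hj', hk', true_and] at hij hjk ⊢
      exact outside_nonadj_trans hF (by omega) hef hi' hj' hk' hl hjl hij hjk
    · refine SimpleGraph.ne_bot_iff_exists_adj.2
        ⟨⟨p.1, hmem hpe⟩, ⟨q.1, hmem hqe⟩, hmem hpe, hmem hqe, hpq⟩
    · rw [SimpleGraph.Subgraph.mem_edgeSet, SimpleGraph.Subgraph.deleteVerts_adj]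
      exact ⟨hmem hpe, p.2, hmem hqe, q.2, hmem hpe, hmem hqe, hpq⟩
  have h₁ := hcm hab hac ⟨d, hcd⟩ (hvn c)
  have h₂ := hcm hcd (fun h => hac h.symm) ⟨b, hab⟩ (hvn a)
  refine ⟨(⊤ : G.Subgraph).induce (outside G v c), (⊤ : G.Subgraph).induce (outside G v a),
    ?_, ?_, h₁.1, h₂.1, h₁.2, h₂.2⟩
  · have hor : ∀ i, i ∈ outside G v c ∨ i ∈ outside G v a := by
      intro i
      by_contra! hi
      simp only [outside, Set.mem_ofPred_eq, not_forall, not_not] at hi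
      obtain ⟨⟨h1, h2⟩, _, h3⟩ := hi
      exact hac (h3.symm.trans h2)
    ext i j
    · simpa using hor i
    · simp only [SimpleGraph.Subgraph.sup_adj, SimpleGraph.Subgraph.induce_adj,
        SimpleGraph.Subgraph.top_adj]
      refine ⟨fun h => h.elim (·.2.2) (·.2.2), fun h => ?_⟩
      by_cases hi : i = v
      · have hiv : ∀ e, i ∈ outside G v e := fun e h' => (h' hi).elim
        exact (hor j).imp (fun hj => ⟨hiv _, hj, h⟩) (fun hj => ⟨hiv _, hj, h⟩)
      by_cases hj : j = v
      · have hjv : ∀ e, j ∈ outside G v e := fun e h' => (h' hj).elim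
        exact (hor i).imp (fun hi => ⟨hi, hjv _, h⟩) (fun hi => ⟨hi, hjv _, h⟩)
      have hij : H.Adj ⟨i, hi⟩ ⟨j, hj⟩ := h
      refine (hor i).imp (fun h' => ⟨h', fun _ hjc => h' hi (hij.reachable.trans hjc), h⟩)
        (fun h' => ⟨h', fun _ hjc => h' hi (hij.reachable.trans hjc), h⟩)
  · ext i
    simp only [SimpleGraph.Subgraph.induce_verts, Set.mem_inter_iff, Set.mem_singleton_iff]
    refine ⟨fun ⟨h1, h2⟩ => ?_, fun h => ⟨fun h' => (h' h).elim, fun h' => (h' h).elim⟩⟩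
    by_contra hi
    exact (hcover ⟨i, hi⟩).elim (h2 hi) (h1 hi)

/-- If all edges of `G - v` lie in one component, then that component is complete multipartite. -/
theorem isMultipartitePlusIsolated_of_minSkewRank (hF : ringChar F ≠ 2)
    (hG : ∀ u : V, ¬ G.IsIsolated u) (hv : IsCutVertex G v) (hr : minSkewRank F G = 4)
    {c d : {x : V // x ≠ v}} (hcd : (deleteVertex G v).Adj c d)
    (hall : ∀ a b, (deleteVertex G v).Adj a b → (deleteVertex G v).Reachable a c) :
    IsMultipartitePlusIsolated (deleteVertex G v) := by
  set H := deleteVertex G v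
  have hW : ∀ x, x ∈ H.connectedComponentMk c ↔ H.Reachable x c := fun x =>
    SimpleGraph.ConnectedComponent.eq
  obtain ⟨u, hu⟩ : ∃ u, ¬ H.Reachable u c := by
    by_contra! h
    obtain ⟨p, q, -, hpq⟩ := hv
    exact hpq ((h p).trans (h q).symm)
  have huiso : ∀ k, ¬ H.Adj u k := fun k hk => hu (hall u k hk)
  have huv : G.Adj u v := by
    obtain ⟨k, hk⟩ := not_isIsolated_iff.1 (hG u)
    by_cases hkv : k = v
    · exact hkv ▸ hk
    · exact (huiso ⟨k, hkv⟩ hk).elim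
  refine ⟨H.connectedComponentMk c, ⟨⟨?_⟩, ?_⟩, fun x hx k hk => hx ((hW x).2 (hall x k hk))⟩
  · rintro ⟨i, hi⟩ ⟨j, hj⟩ ⟨k, hk⟩ hij hjk
    obtain ⟨l, hjl⟩ : ∃ l, H.Adj j l := by
      by_cases hjc : j = c
      · exact ⟨d, hjc ▸ hcd⟩
      · obtain ⟨p⟩ := (hW j).1 hj
        cases p with
        | nil => exact (hjc rfl).elim
        | cons h _ => exact ⟨_, h⟩
    -- Pivot on `uv`: as `u` has no neighbour other than `v`, all of `G - v` is unaffected.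
    refine nonadj_trans_of_minSkewRank_lt_six hF (by omega) huv (R := {i | i ≠ v}) ?_
      i.2 j.2 k.2 l.2 hjl hij hjk
    intro p hp q hq _
    exact ⟨.inl fun h => huiso ⟨p, hp⟩ h.symm, .inr fun h => huiso ⟨q, hq⟩ h⟩
  · refine SimpleGraph.ne_bot_iff_exists_adj.2 ⟨⟨c, (hW c).2 .rfl⟩, ⟨d, (hW d).2 ?_⟩, hcd⟩
    exact hcd.symm.reachable

theorem minSkewRank_le_two_of_deleteVertex_eq_bot (h : deleteVertex G v = ⊥) :
    minSkewRank F G ≤ 2 := by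
  classical
  refine minSkewRank_le_two (x := Pi.single v 1) (y := fun j => if G.Adj v j then 1 else 0)
    fun i j => ?_
  by_cases hi : i = v <;> by_cases hj : j = v
  · subst hi hj
    simp
  · subst hi
    simp [hj]
  · subst hj
    simp [hi, G.adj_comm]
  · have : ¬ (deleteVertex G v).Adj ⟨i, hi⟩ ⟨j, hj⟩ := by simp [h]
    simpa [hi, hj] using this

end Necessity

end MinSkewRank

theorem mainTheorem1 {F : Type*} [Field F] [Infinite F] (hF : ringChar F ≠ 2)
    {V : Type*} [Fintype V] (G : SimpleGraph V) (hG : ∀ u : V, ¬ G.IsIsolated u)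
    (v : V) (hv : MinSkewRank.IsCutVertex G v) :
    MinSkewRank.minSkewRank F G = 4 ↔
      (MinSkewRank.IsMultipartiteUnionAt G v ∨
        MinSkewRank.IsMultipartitePlusIsolated (MinSkewRank.deleteVertex G v)) := by
  refine ⟨fun hr => ?_, fun h => h.elim (fun h => h.minSkewRank_eq_four hF)
    (fun h => h.minSkewRank_eq_four hF hG hv)⟩
  have hne : MinSkewRank.deleteVertex G v ≠ ⊥ := fun h => by
    have := MinSkewRank.minSkewRank_le_two_of_deleteVertex_eq_bot (F := F) h
    omega
  obtain ⟨c, d, hcd⟩ := SimpleGraph.ne_bot_iff_exists_adj.1 hne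
  by_cases hall : ∀ a b, (MinSkewRank.deleteVertex G v).Adj a b →
      (MinSkewRank.deleteVertex G v).Reachable a c
  · exact .inr (MinSkewRank.isMultipartitePlusIsolated_of_minSkewRank hF hG hv hr hcd hall)
  · push Not at hall
    obtain ⟨a, b, hab, hac⟩ := hall
    exact .inl (MinSkewRank.isMultipartiteUnionAt_of_minSkewRank hF hG hv hr hab hcd hac)
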